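/- **Theorem (boundedness of the ratio $\lambda_k/\lambda_1$).** Let $N\ge 2$ and $k\ge 1$ be integers. There is a constant $M=M(k,N)\in(0,\infty)$ such that for every quasi-open (in particular, every open) set $A\subseteq\mathbb R^N$, of any finite or infinite measure, $$\lambda_k(A)\le M\,\lambda_1(A).$$ Here $\lambda_1(A)\le\lambda_2(A)\le\dots$ are the eigenvalues of the Dirichlet Laplacian on $A$, counted with multiplicity; on an arbitrary quasi-open set they are understood as the min-max levels $$\lambda_j(A)=\inf_{K}\ \sup_{w\in K\setminus\{0\}}\frac{\int|Dw|^2}{\int w^2}\in[0,\infty],$$ $K$ ranging over the $j$-dimensional subspaces of $W^{1,2}_0(A)$, with $\inf\emptyset=\infty$. With the same constant $M$, if the Dirichlet Laplacian on $A$ has discrete spectrum, i.e. if $L^2(A)$ has an orthonormal basis $(u_i)_{i\ge1}\subseteq W_0^{1,2}(A)$ with $\int Du_i\cdot Dv=\mu_i\int u_iv$ for all $v\in W^{1,2}_0(A)$ and $\mu_1\le\mu_2\le\cdots$, then also $\mu_k\le M\mu_1$. The notions used are as follows. The capacity of $S\subseteq\mathbb R^N$ is $\mathrm{cap}(S)=\inf\{\int\varphi^2+\int|D\varphi|^2\}$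 over all $0\le\varphi\in W^{1,2}(\mathbb R^N)$ with $\varphi\ge1$ a.e. in a neighbourhood of $S$. The set $A$ is quasi-open if for every ball $B$ and every $\varepsilon>0$ there is an open set $U\supseteq A\cap B$ with $\mathrm{cap}(U\setminus(A\cap B))<\varepsilon$. A function is quasi-continuous if for every $\varepsilon>0$ there is an open set $G$ with $\mathrm{cap}(G)<\varepsilon$ outside which it is continuous. Finally, $W^{1,2}_0(A)$ is the space of all $u\in W^{1,2}(\mathbb R^N)$ having a quasi-continuous representative that vanishes outside $A$ up to a set of zero capacity. -/

import Mathlib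

open MeasureTheory
open scoped ENNReal ContDiff

noncomputable section

namespace DirichletSpectrum

/-- The Euclidean space `ℝ^N`. -/
abbrev E (N : ℕ) : Type := EuclideanSpace ℝ (Fin N)

/-- The Hilbert space `L²(ℝ^N)` of real valued functions. -/
abbrev L2 (N : ℕ) : Type := Lp ℝ 2 (volume : Measure (E N))

/-- The Hilbert space `L²(ℝ^N; ℝ^N)` of vector fields. -/
abbrev L2Vec (N : ℕ) : Type := Lp (E N) 2 (volume : Measure (E N))

variable {N : ℕ}

/-- `g` is the distributional gradient of `u`:
`∫ u ∇φ = - ∫ φ g` for every test function `φ ∈ C_c^∞(ℝ^N)`. -/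
def HasWeakGradient (u : L2 N) (g : L2Vec N) : Prop :=
  ∀ φ : E N → ℝ, ContDiff ℝ ∞ φ → HasCompactSupport φ →
    ∫ x, u x • gradient φ x = - ∫ x, φ x • g x

/-- The weak gradient is unique. -/
theorem HasWeakGradient.unique {u : L2 N} {g₁ g₂ : L2Vec N}
    (h₁ : HasWeakGradient u g₁) (h₂ : HasWeakGradient u g₂) : g₁ = g₂ := by
  apply Lp.ext
  refine ae_eq_of_integral_contDiff_smul_eq
    ((Lp.memLp g₁).locallyIntegrable (by norm_num))
    ((Lp.memLp g₂).locallyIntegrable (by norm_num)) ?_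
  intro φ hφ hc
  exact neg_injective ((h₁ φ hφ hc).symm.trans (h₂ φ hφ hc))

/-- The Sobolev space `W^{1,2}(ℝ^N)`: the square integrable functions with a square integrable
distributional gradient. -/
def W12 (N : ℕ) : Set (L2 N) := {u | ∃ g : L2Vec N, HasWeakGradient u g}

open Classical in
/-- The weak gradient `Du ∈ L²(ℝ^N; ℝ^N)` of `u ∈ W^{1,2}(ℝ^N)` (and `0` for other `u`). -/
def weakGrad (u : L2 N) : L2Vec N :=
  if h : ∃ g : L2Vec N, HasWeakGradient u g then h.choose else 0

theorem HasWeakGradient.weakGrad_eq {u : L2 N} {g : L2Vec N} (h : HasWeakGradient u g) :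
    weakGrad u = g := by
  have h' : ∃ g : L2Vec N, HasWeakGradient u g := ⟨g, h⟩
  rw [weakGrad, dif_pos h']
  exact h'.choose_spec.unique h

/-- The Sobolev capacity of `S ⊆ ℝ^N`: the infimum of `∫ φ² + ∫ |Dφ|²` over the nonnegative
`φ ∈ W^{1,2}(ℝ^N)` with `φ ≥ 1` almost everywhere in a neighbourhood of `S`. -/
def capacity (S : Set (E N)) : ℝ≥0∞ :=
  ⨅ (φ : L2 N) (_ : φ ∈ W12 N) (_ : ∀ᵐ x, 0 ≤ φ x)
    (_ : ∃ U : Set (E N), IsOpen U ∧ S ⊆ U ∧ ∀ᵐ x, x ∈ U → 1 ≤ φ x),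
    ENNReal.ofReal (‖φ‖ ^ 2 + ‖weakGrad φ‖ ^ 2)

/-- A set `A ⊆ ℝ^N` is quasi-open if, for every ball `B`, the bounded set `A ∩ B` is contained in
open sets `U` such that `U \ (A ∩ B)` has arbitrarily small capacity. -/
def IsQuasiOpen (A : Set (E N)) : Prop :=
  ∀ (c : E N) (r : ℝ) (ε : ℝ≥0∞), 0 < ε →
    ∃ U : Set (E N), IsOpen U ∧ A ∩ Metric.ball c r ⊆ U ∧
      capacity (U \ (A ∩ Metric.ball c r)) < ε

/-- A function is quasi-continuous if it is continuous off open sets of arbitrarily small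
capacity. -/
def QuasiContinuous (v : E N → ℝ) : Prop :=
  ∀ ε : ℝ≥0∞, 0 < ε → ∃ G : Set (E N), IsOpen G ∧ capacity G < ε ∧ ContinuousOn v Gᶜ

/-- The space `W_0^{1,2}(A)`: the functions of `W^{1,2}(ℝ^N)` whose quasi-continuous
representative vanishes quasi-everywhere (that is, up to a set of zero capacity) outside `A`. -/
def W012 (A : Set (E N)) : Set (L2 N) :=
  {u | u ∈ W12 N ∧ ∃ v : E N → ℝ, QuasiContinuous v ∧ v =ᵐ[volume] u ∧
    capacity {x | x ∉ A ∧ v x ≠ 0} = 0}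

/-- The Rayleigh quotient `∫ |Dw|² / ∫ w²`. -/
def rayleigh (w : L2 N) : ℝ := ‖weakGrad w‖ ^ 2 / ‖w‖ ^ 2

/-- The `j`-th eigenvalue (`j ≥ 1`, counted with multiplicity) of the Dirichlet Laplacian on an
arbitrary quasi-open set: the min-max level
`λ_j(A) = inf_K sup_{w ∈ K, w ≠ 0} ∫ |Dw|² / ∫ w²`, over the `j`-dimensional subspaces `K` of
`W_0^{1,2}(A)`; it is `∞` if there is no such subspace. -/
def dirichletEigenvalue (A : Set (E N)) (j : ℕ) : ℝ≥0∞ :=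
  ⨅ (K : Submodule ℝ (L2 N)) (_ : Module.finrank ℝ K = j) (_ : (K : Set (L2 N)) ⊆ W012 A),
    ⨆ (w : L2 N) (_ : w ∈ K) (_ : w ≠ 0), ENNReal.ofReal (rayleigh w)

/-- The Dirichlet Laplacian on `A` has discrete spectrum `μ 0 ≤ μ 1 ≤ μ 2 ≤ …`, with multiplicity:
there is an orthonormal basis of `L²(A)` consisting of functions `u i ∈ W_0^{1,2}(A)` that are weak
solutions of `-Δ (u i) = μ i • u i`. So `μ (j - 1)` is the `j`-th eigenvalue. -/
def IsDirichletSpectrum (A : Set (E N)) (μ : ℕ → ℝ) : Prop :=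
  Monotone μ ∧ ∃ u : ℕ → L2 N,
    Orthonormal ℝ u ∧
    (∀ i, u i ∈ W012 A) ∧
    (∀ i, ∀ v ∈ W012 A, inner ℝ (weakGrad (u i)) (weakGrad v) = μ i * inner ℝ (u i) v) ∧
    (∀ f : L2 N, (∀ᵐ x, x ∉ A → f x = 0) → (∀ i, inner ℝ (u i) f = 0) → f = 0)

end DirichletSpectrum

end

/-!
The ratio bound is a property of a single Sobolev function. Let `w ∈ W_0^{1,2}(A)` satisfy
`∫ |Dw|² ≤ lam ∫ w²`. Multiplying `w` by a bounded smooth function with bounded gradient does not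
leave `W_0^{1,2}(A)` (`mul_smooth_mem_W012`), so it suffices to find `k` cutoff functions with
gradients of size `√lam` which separate the mass `w² dx` into `k` comparable portions: on the
`k`-dimensional span of their products with `w` the Rayleigh quotient is at most `M(k) lam`
(`exists_testSpace`). This works even if the first level is not attained.

Such cutoffs exist, as functions of one coordinate, because `w` cannot concentrate at scales below
`1 / √lam`. The translation estimate `‖w(· + y) - w‖ ≤ ‖y‖ ‖Dw‖` (`integral_sq_translate_sub_le`)
shows that a slab narrower than `1 / (√lam n²)` has `n` disjoint translates of almost the same mass,
hence carries at most the fraction `4 / n` of the total (`massBelow_add_le`). So consecutive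
`(k + 2)`-quantiles of the mass distribution along the coordinate are at distance at least a
constant over `√lam`, and smooth steps starting at the quantiles give the cutoffs
(`exists_cutoffs`).

For the min-max levels the conclusion follows by taking `lam` close to the Rayleigh quotient of an
arbitrary competitor for the first level. For a discrete spectrum, `w` is the first eigenfunction;
the test space contains a nonzero function orthogonal to the first `k - 1` eigenfunctions, and
its Rayleigh quotient is at least the `k`-th eigenvalue by Parseval's identity and Bessel's
inequality (`le_norm_weakGrad_sq`).
-/

namespace DirichletSpectrum

variable {N : ℕ}

/-! ### Weak gradients: multiplication by smooth functions -/

theorem norm_sq_eq_integral (w : L2 N) : ‖w‖ ^ 2 = ∫ x, w x ^ 2 := by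
  rw [← real_inner_self_eq_norm_sq, L2.inner_def]
  exact integral_congr_ae (.of_forall fun x => by simp)

theorem norm_sq_eq_integral_vec (g : L2Vec N) : ‖g‖ ^ 2 = ∫ x, ‖g x‖ ^ 2 := by
  rw [← real_inner_self_eq_norm_sq, L2.inner_def]
  exact integral_congr_ae (.of_forall fun x => by simp)

theorem integrable_sq (w : L2 N) : Integrable fun x => w x ^ 2 :=
  (Lp.memLp w).integrable_sq

theorem integrable_norm_sq_vec (g : L2Vec N) : Integrable fun x => ‖g x‖ ^ 2 :=
  (memLp_two_iff_integrable_sq_norm (Lp.memLp g).1).1 (Lp.memLp g)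

theorem locallyIntegrable_L2 (w : L2 N) : LocallyIntegrable w :=
  (Lp.memLp w).locallyIntegrable (by norm_num)

theorem locallyIntegrable_L2Vec (g : L2Vec N) : LocallyIntegrable g :=
  (Lp.memLp g).locallyIntegrable (by norm_num)

theorem continuous_gradient {φ : E N → ℝ} (hφ : ContDiff ℝ ∞ φ) : Continuous (gradient φ) :=
  (InnerProductSpace.toDual ℝ (E N)).symm.continuous.comp (hφ.continuous_fderiv (by simp))

theorem hasCompactSupport_gradient {φ : E N → ℝ} (hφ : HasCompactSupport φ) :
    HasCompactSupport (gradient φ) :=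
  (hφ.fderiv ℝ).comp_left (g := (InnerProductSpace.toDual ℝ (E N)).symm) (map_zero _)

theorem integrable_smul_gradient (w : L2 N) {φ : E N → ℝ} (hφ : ContDiff ℝ ∞ φ)
    (hc : HasCompactSupport φ) : Integrable fun x => w x • gradient φ x :=
  (locallyIntegrable_L2 w).integrable_smul_right_of_hasCompactSupport
    (continuous_gradient hφ) (hasCompactSupport_gradient hc)

theorem integrable_smul_vec (g : L2Vec N) {φ : E N → ℝ} (hφ : Continuous φ)
    (hc : HasCompactSupport φ) : Integrable fun x => φ x • g x :=
  (locallyIntegrable_L2Vec g).integrable_smul_left_of_hasCompactSupport hφ hc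

theorem hasWeakGradient_weakGrad {u : L2 N} (hu : u ∈ W12 N) : HasWeakGradient u (weakGrad u) := by
  obtain ⟨g, hg⟩ := hu
  rwa [hg.weakGrad_eq]

theorem gradient_mul {φ ψ : E N → ℝ} {x : E N} (hφ : DifferentiableAt ℝ φ x)
    (hψ : DifferentiableAt ℝ ψ x) :
    gradient (fun y => φ y * ψ y) x = φ x • gradient ψ x + ψ x • gradient φ x := by
  simp only [gradient]
  rw [fderiv_fun_mul hφ hψ]
  simp

/-- The product rule `D(Φu) = Φ Du + u DΦ` for a smooth multiplier `Φ`. -/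
theorem HasWeakGradient.mul_smooth {u v : L2 N} {g h : L2Vec N} (hu : HasWeakGradient u g)
    {Φ : E N → ℝ} (hΦ : ContDiff ℝ ∞ Φ) (hv : v =ᵐ[volume] fun x => Φ x * u x)
    (hh : h =ᵐ[volume] fun x => Φ x • g x + u x • gradient Φ x) :
    HasWeakGradient v h := by
  intro φ hφ hc
  have hΦφ : ContDiff ℝ ∞ fun x => Φ x * φ x := hΦ.mul hφ
  have hc' : HasCompactSupport fun x => Φ x * φ x := hc.mul_left
  have i1 := integrable_smul_gradient u hΦφ hc'
  have i2 : Integrable fun x => u x • (φ x • gradient Φ x) :=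
    (locallyIntegrable_L2 u).integrable_smul_right_of_hasCompactSupport
      (hφ.continuous.smul (continuous_gradient hΦ)) hc.smul_right
  have i3 := integrable_smul_vec g hΦφ.continuous hc'
  have h1 : ∫ x, v x • gradient φ x = ∫ x,
      (u x • gradient (fun y => Φ y * φ y) x - u x • (φ x • gradient Φ x)) := by
    refine integral_congr_ae ?_
    filter_upwards [hv] with x hx
    rw [hx, gradient_mul (hΦ.differentiable (by simp) x) (hφ.differentiable (by simp) x), smul_add,
      add_sub_cancel_right, smul_smul, mul_comm]
  have h2 : ∫ x, φ x • h x = ∫ x, ((Φ x * φ x) • g x + u x • (φ x • gradient Φ x)) := by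
    refine integral_congr_ae ?_
    filter_upwards [hh] with x hx
    rw [hx, smul_add, smul_smul, mul_comm, smul_comm]
  rw [h1, h2, integral_sub i1 i2, integral_add i3 i2, hu _ hΦφ hc']
  abel

/-! ### The translation estimate -/

/-- For a test function `ψ`, the function `t ↦ (w ⋆ ψ)(t y)` is Lipschitz with constant
`‖y‖ ‖Dw‖ ‖ψ‖`: its derivative is `∫ ψ(ty - x) ⟪Dw(x), y⟫ dx`. -/
theorem abs_integral_mul_translate_sub_le {w : L2 N} {g : L2Vec N} (hw : HasWeakGradient w g)
    (y : E N) {ψ : E N → ℝ} (hψ : ContDiff ℝ ∞ ψ) (hc : HasCompactSupport ψ) :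
    |(∫ x, w x * ψ (y - x)) - ∫ x, w x * ψ (-x)| ≤
      ‖y‖ * ‖g‖ * √(∫ x, ψ x ^ 2) := by
  let L := ContinuousLinearMap.mul ℝ ℝ
  let G : ℝ → ℝ := fun t => ∫ x, w x * ψ (t • y - x)
  let G' : ℝ → ℝ := fun t => ∫ x, w x * fderiv ℝ ψ (t • y - x) y
  have hG : ∀ t, HasDerivAt G (G' t) t := by
    intro t
    have h1 := hc.hasFDerivAt_convolution_right L (locallyIntegrable_L2 w) (hψ.of_le (by simp))
      (t • y)
    have h2 : HasDerivAt (fun t : ℝ => t • y) y t := by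
      simpa using (hasDerivAt_id t).smul_const y
    have h3 := h1.comp_hasDerivAt t h2
    rw [convolution_precompR_apply L (locallyIntegrable_L2 w) (hc.fderiv ℝ)
      (hψ.continuous_fderiv (by simp))] at h3
    exact h3
  have hbound : ∀ t, ‖G' t‖ ≤ ‖y‖ * ‖g‖ * √(∫ x, ψ x ^ 2) := by
    intro t
    let φ : E N → ℝ := fun x => ψ (t • y - x)
    have hφ : ContDiff ℝ ∞ φ := hψ.comp (contDiff_const.sub contDiff_id)
    have hφc : HasCompactSupport φ := hc.comp_homeomorph (Homeomorph.subLeft (t • y))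
    have hgrad : ∀ x, fderiv ℝ φ x = - fderiv ℝ ψ (t • y - x) := by
      intro x
      have h1 := ((hψ.differentiable (by simp)) (t • y - x)).hasFDerivAt.comp x
        ((hasFDerivAt_id x).const_sub (t • y))
      exact h1.fderiv.trans (by ext; simp)
    have hφL : MemLp φ 2 (volume : Measure (E N)) := hφ.continuous.memLp_of_hasCompactSupport hφc
    have hnorm : ‖hφL.toLp φ‖ = √(∫ x, ψ x ^ 2) := by
      rw [← Real.sqrt_sq (norm_nonneg (hφL.toLp φ)), norm_sq_eq_integral]
      congr 1
      rw [← integral_sub_left_eq_self (fun x => ψ x ^ 2) volume (t • y)]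
      refine integral_congr_ae ?_
      filter_upwards [hφL.coeFn_toLp] with x hx
      rw [hx]
    have e1 : G' t = inner ℝ y (∫ x, φ x • g x) := by
      have := hw φ hφ hφc
      rw [eq_neg_iff_add_eq_zero, add_comm, ← eq_neg_iff_add_eq_zero] at this
      rw [this, ← integral_neg, ← integral_inner]
      · refine integral_congr_ae (.of_forall fun x => ?_)
        simp only [inner_neg_right, inner_smul_right]
        rw [real_inner_comm, gradient, InnerProductSpace.toDual_symm_apply, hgrad]
        simp
      · exact (integrable_smul_gradient w hφ hφc).neg
    rw [e1]
    have e3 : ‖∫ x, φ x • g x‖ ≤ ‖g‖ * √(∫ x, ψ x ^ 2) := by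
      calc ‖∫ x, φ x • g x‖ ≤ ∫ x, ‖φ x‖ * ‖g x‖ := by
            refine (norm_integral_le_integral_norm _).trans_eq ?_
            simp only [norm_smul]
        _ ≤ (∫ x, ‖φ x‖ ^ (2 : ℝ)) ^ (1 / (2 : ℝ)) * (∫ x, ‖g x‖ ^ (2 : ℝ)) ^ (1 / (2 : ℝ)) :=
            by simpa only [norm_norm] using
              integral_mul_norm_le_Lp_mul_Lq (f := fun x => ‖φ x‖) (g := fun x => ‖g x‖)
                Real.HolderConjugate.two_two
                (by simpa using hφL.norm) (by simpa using (Lp.memLp g).norm)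
        _ = ‖g‖ * √(∫ x, ψ x ^ 2) := by
            rw [← Real.sqrt_eq_rpow, ← Real.sqrt_eq_rpow, mul_comm]
            congr 1
            · rw [← Real.sqrt_sq (norm_nonneg g), norm_sq_eq_integral_vec]
              simp
            · rw [← integral_sub_left_eq_self (fun x => ψ x ^ 2) volume (t • y)]
              simp [φ]
    calc ‖inner ℝ y (∫ x, φ x • g x)‖ ≤ ‖y‖ * ‖∫ x, φ x • g x‖ := norm_inner_le_norm _ _
      _ ≤ ‖y‖ * (‖g‖ * √(∫ x, ψ x ^ 2)) := by gcongr
      _ = _ := by ring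
  have := Convex.norm_image_sub_le_of_norm_hasDerivWithin_le (s := Set.univ) (x := 0) (y := 1)
    (fun t _ => (hG t).hasDerivWithinAt) (fun t _ => hbound t) convex_univ trivial trivial
  simpa [G] using this

/-- `‖w(· + y) - w‖ ≤ ‖y‖ ‖Dw‖`, by duality with test functions. -/
theorem integral_sq_translate_sub_le {w : L2 N} {g : L2Vec N} (hw : HasWeakGradient w g)
    (y : E N) : ∫ x, (w (x + y) - w x) ^ 2 ≤ ‖y‖ ^ 2 * ‖g‖ ^ 2 := by
  have hmp : MeasurePreserving (fun x : E N => x + y) volume volume :=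
    measurePreserving_add_right volume y
  let d : L2 N := Lp.compMeasurePreserving _ hmp w - w
  have hd : d =ᵐ[volume] fun x => w (x + y) - w x := by
    filter_upwards [Lp.coeFn_sub (Lp.compMeasurePreserving _ hmp w) w,
      Lp.coeFn_compMeasurePreserving w hmp] with x h1 h2
    rw [h1, Pi.sub_apply, h2, Function.comp_apply]
  have key : ∀ f : L2 N, |inner ℝ d f| ≤ ‖y‖ * ‖g‖ * ‖f‖ := by
    intro f
    refine (Lp.dense_hasCompactSupport_contDiff (F := ℝ) (p := 2)
      (μ := (volume : Measure (E N))) (by norm_num)).induction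
      (P := fun f => |inner ℝ d f| ≤ ‖y‖ * ‖g‖ * ‖f‖) ?_
      (isClosed_le (by fun_prop) (by fun_prop)) f
    rintro f ⟨φ, hfφ, hc, hφ⟩
    have hf : ‖f‖ = √(∫ x, φ (-x) ^ 2) := by
      rw [← Real.sqrt_sq (norm_nonneg f), norm_sq_eq_integral,
        integral_neg_eq_self (fun x => φ x ^ 2) volume]
      congr 1
      refine integral_congr_ae ?_
      filter_upwards [hfφ] with x hx
      rw [hx]
    have hψ : ContDiff ℝ ∞ fun x => φ (-x) := hφ.comp contDiff_neg
    have hψc : HasCompactSupport fun x => φ (-x) := hc.comp_homeomorph (Homeomorph.neg (E N))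
    have hint : ∀ z : E N, Integrable fun x => w x * φ (x - z) := by
      intro z
      exact (locallyIntegrable_L2 w).integrable_smul_right_of_hasCompactSupport
        (g := fun x => φ (x - z)) (hφ.continuous.comp (continuous_id.sub continuous_const))
        (hc.comp_homeomorph (Homeomorph.subRight z))
    have hin : inner ℝ d f = (∫ x, w x * φ (x - y)) - ∫ x, w x * φ x := by
      have h1 : ∫ x, w x * φ (x - y) = ∫ x, w (x + y) * φ x := by
        rw [← integral_add_right_eq_self (fun x => w x * φ (x - y)) y]
        simp
      have i1 : Integrable fun x => w (x + y) * φ x := by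
        simpa using (hint y).comp_add_right y
      have i0 : Integrable fun x => w x * φ x := by simpa using hint 0
      rw [h1, ← integral_sub i1 i0, L2.inner_def]
      refine integral_congr_ae ?_
      filter_upwards [hd, hfφ] with x h1 h2
      rw [h1, h2]
      simp
      ring
    have := abs_integral_mul_translate_sub_le hw y hψ hψc
    simp only [neg_sub, neg_neg] at this
    rw [hin, hf]
    exact this
  have h1 : ‖d‖ ≤ ‖y‖ * ‖g‖ := by
    have := key d
    rw [real_inner_self_eq_norm_sq, abs_of_nonneg (by positivity), sq] at this
    by_contra! h
    have hpos : 0 < ‖d‖ := lt_of_le_of_lt (by positivity) h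
    nlinarith
  calc ∫ x, (w (x + y) - w x) ^ 2 = ‖d‖ ^ 2 := by
        rw [norm_sq_eq_integral]
        refine integral_congr_ae ?_
        filter_upwards [hd] with x hx
        rw [hx]
    _ ≤ (‖y‖ * ‖g‖) ^ 2 := by gcongr
    _ = _ := by ring

/-! ### The distribution of the mass of a Sobolev function along a coordinate -/

/-- The mass `∫ w²` of `w` in the half space `x i < t`. -/
noncomputable def massBelow (w : L2 N) (i : Fin N) (t : ℝ) : ℝ :=
  ∫ x in {x : E N | x i < t}, w x ^ 2

theorem measurable_coord (i : Fin N) : Measurable fun x : E N => x i :=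
  (EuclideanSpace.proj (𝕜 := ℝ) i).continuous.measurable

theorem measurableSet_coord_lt (i : Fin N) (t : ℝ) : MeasurableSet {x : E N | x i < t} :=
  measurable_coord i measurableSet_Iio

theorem measurableSet_slab (i : Fin N) (a b : ℝ) :
    MeasurableSet {x : E N | a ≤ x i ∧ x i < b} :=
  measurable_coord i measurableSet_Ico

theorem massBelow_mono (w : L2 N) (i : Fin N) : Monotone (massBelow w i) := fun _ _ h =>
  setIntegral_mono_set (integrable_sq w).integrableOn (.of_forall fun _ => sq_nonneg _)
    (.of_forall fun _ hx => lt_of_lt_of_le hx h)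

theorem massBelow_nonneg (w : L2 N) (i : Fin N) (t : ℝ) : 0 ≤ massBelow w i t :=
  integral_nonneg fun _ => sq_nonneg _

theorem massBelow_le (w : L2 N) (i : Fin N) (t : ℝ) : massBelow w i t ≤ ‖w‖ ^ 2 := by
  rw [norm_sq_eq_integral]
  exact setIntegral_le_integral (integrable_sq w) (.of_forall fun _ => sq_nonneg _)

theorem integral_slab (w : L2 N) (i : Fin N) {a b : ℝ} (hab : a ≤ b) :
    ∫ x in {x : E N | a ≤ x i ∧ x i < b}, w x ^ 2 = massBelow w i b - massBelow w i a := by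
  have h : {x : E N | a ≤ x i ∧ x i < b} = {x : E N | x i < b} \ {x : E N | x i < a} := by
    ext x
    simp [and_comm]
  rw [h, setIntegral_sdiff (s := {x : E N | x i < b}) (t := {x : E N | x i < a})
    (measurableSet_coord_lt i a) (integrable_sq w).integrableOn
    (fun x hx => lt_of_lt_of_le hx hab)]
  rfl

/-- A Sobolev function with `∫ |Dw|² ≤ lam ∫ w²` does not concentrate at scales below `1 / √lam`:
a slab of width `l ≤ 1 / (√lam n²)` carries at most the fraction `4 / n` of the mass, because by
the translation estimate its `n` adjacent translates carry almost as much. -/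
theorem massBelow_add_le {w : L2 N} {g : L2Vec N} (hw : HasWeakGradient w g) (i : Fin N)
    {lam : ℝ} (hlam : 0 < lam) (hg : ‖g‖ ^ 2 ≤ lam * ‖w‖ ^ 2) {n : ℕ} (hn : 0 < n) {l : ℝ}
    (hl : 0 < l) (hln : l ≤ 1 / (√lam * (n : ℝ) ^ 2)) (a : ℝ) :
    massBelow w i (a + l) ≤ massBelow w i a + 4 / n * ‖w‖ ^ 2 := by
  have hn0 : (0 : ℝ) < n := by exact_mod_cast hn
  have hn1 : (1 : ℝ) ≤ n := by exact_mod_cast hn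
  set m : ℝ := massBelow w i (a + l) - massBelow w i a with hm
  have hl2 : l ^ 2 * lam ≤ 1 / (n : ℝ) ^ 4 := by
    calc l ^ 2 * lam ≤ (1 / (√lam * (n : ℝ) ^ 2)) ^ 2 * lam := by gcongr
      _ = 1 / (n : ℝ) ^ 4 := by
        rw [div_pow, mul_pow, Real.sq_sqrt hlam.le]
        field_simp
  -- Compare the slab with its translate by `J l`, losing `‖w(· + J l e_i) - w‖²`.
  have step : ∀ J ∈ Finset.range n, m ≤
      2 * (massBelow w i (a + (J + 1 : ℕ) * l) - massBelow w i (a + J * l))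
        + 2 * ‖w‖ ^ 2 / n := by
    intro J hJ
    have hJn : (J : ℝ) ≤ n := by exact_mod_cast (Finset.mem_range.1 hJ).le
    let y : E N := EuclideanSpace.single i (J * l)
    have hy : ‖y‖ ^ 2 = J ^ 2 * l ^ 2 := by
      simp [y, mul_pow]
    let S : ℝ → ℝ → Set (E N) := fun b c => {x : E N | b ≤ x i ∧ x i < c}
    have htr := integral_sq_translate_sub_le hw y
    have hmp : MeasurePreserving (MeasurableEquiv.addRight y) (volume : Measure (E N)) volume :=
      measurePreserving_add_right volume y
    have hpre : (MeasurableEquiv.addRight y) ⁻¹' S (a + J * l) (a + (J + 1 : ℕ) * l)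
        = S a (a + l) := by
      ext x
      simp only [S, y, MeasurableEquiv.coe_addRight, Set.mem_preimage, Set.mem_ofPred_eq,
        PiLp.add_apply, PiLp.single_apply, if_true, Nat.cast_add, Nat.cast_one]
      constructor <;> rintro ⟨h1, h2⟩ <;> constructor <;> linarith
    have hshift : ∫ x in S a (a + l), w (x + y) ^ 2
        = massBelow w i (a + (J + 1 : ℕ) * l) - massBelow w i (a + J * l) := by
      rw [← integral_slab w i (by push_cast; linarith), ← hpre]
      exact hmp.setIntegral_preimage_emb (MeasurableEquiv.addRight y).measurableEmbedding
        (fun x => w x ^ 2) _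
    have i1 : Integrable fun x => w (x + y) ^ 2 := (integrable_sq w).comp_add_right y
    have i2 : Integrable fun x => (w (x + y) - w x) ^ 2 :=
      (((Lp.memLp w).comp_measurePreserving hmp).sub (Lp.memLp w)).integrable_sq
    calc m = ∫ x in S a (a + l), w x ^ 2 := (integral_slab w i (by linarith)).symm
      _ ≤ ∫ x in S a (a + l), (2 * w (x + y) ^ 2 + 2 * (w (x + y) - w x) ^ 2) := by
          refine integral_mono (integrable_sq w).integrableOn
            ((i1.const_mul 2).add (i2.const_mul 2)).integrableOn fun x => ?_
          dsimp only
          nlinarith [sq_nonneg (2 * w (x + y) - w x)]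
      _ = 2 * (∫ x in S a (a + l), w (x + y) ^ 2)
            + 2 * ∫ x in S a (a + l), (w (x + y) - w x) ^ 2 := by
          rw [integral_add (i1.const_mul 2).integrableOn (i2.const_mul 2).integrableOn,
            integral_const_mul, integral_const_mul]
      _ ≤ 2 * (massBelow w i (a + (J + 1 : ℕ) * l) - massBelow w i (a + J * l))
            + 2 * (‖w‖ ^ 2 / n) := by
          rw [hshift]
          gcongr
          calc ∫ x in S a (a + l), (w (x + y) - w x) ^ 2 ≤ ∫ x, (w (x + y) - w x) ^ 2 :=
                setIntegral_le_integral i2 (.of_forall fun _ => sq_nonneg _)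
            _ ≤ (J ^ 2 * l ^ 2) * ‖g‖ ^ 2 := hy ▸ htr
            _ ≤ ((n : ℝ) ^ 2 * l ^ 2) * (lam * ‖w‖ ^ 2) := by gcongr
            _ = (n : ℝ) ^ 2 * (l ^ 2 * lam) * ‖w‖ ^ 2 := by ring
            _ ≤ (n : ℝ) ^ 2 * (1 / (n : ℝ) ^ 4) * ‖w‖ ^ 2 := by gcongr
            _ = ‖w‖ ^ 2 / n / n := by field_simp
            _ ≤ ‖w‖ ^ 2 / n := div_le_self (by positivity) hn1
      _ = _ := by ring
  -- The masses of the `n` adjacent translates telescope to at most the total mass.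
  have hsum := Finset.sum_le_sum step
  rw [Finset.sum_const, Finset.card_range, nsmul_eq_mul, Finset.sum_add_distrib, ← Finset.mul_sum,
    Finset.sum_range_sub (fun J : ℕ => massBelow w i (a + J * l)), Finset.sum_const,
    Finset.card_range, nsmul_eq_mul, mul_div_cancel₀ _ hn0.ne'] at hsum
  have h1 := massBelow_le w i (a + n * l)
  have h2 := massBelow_nonneg w i (a + (0 : ℕ) * l)
  have h3 : m ≤ 4 / n * ‖w‖ ^ 2 := by
    rw [div_mul_eq_mul_div, le_div_iff₀ hn0]
    linarith
  linarith

theorem continuous_massBelow {w : L2 N} {g : L2Vec N} (hw : HasWeakGradient w g) (i : Fin N)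
    {lam : ℝ} (hlam : 0 < lam) (hg : ‖g‖ ^ 2 ≤ lam * ‖w‖ ^ 2) : Continuous (massBelow w i) := by
  rw [Metric.continuous_iff]
  intro b ε hε
  obtain ⟨n, hn⟩ := exists_nat_gt (max 0 (4 * ‖w‖ ^ 2 / ε))
  have hn0 : (0 : ℝ) < n := lt_of_le_of_lt (le_max_left _ _) hn
  have hnε : 4 / n * ‖w‖ ^ 2 < ε := by
    rw [div_mul_eq_mul_div, div_lt_iff₀ hn0, mul_comm ε, ← div_lt_iff₀ hε]
    exact lt_of_le_of_lt (le_max_right _ _) hn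
  have hl : 0 < 1 / (√lam * (n : ℝ) ^ 2) := by positivity
  have hadd := massBelow_add_le hw i hlam hg (Nat.cast_pos.1 hn0) hl le_rfl
  refine ⟨_, hl, fun a ha => ?_⟩
  rw [Real.dist_eq, abs_lt] at ha ⊢
  have h1 := hadd a
  have h2 := hadd b
  have h3 := massBelow_mono w i (show a ≤ b + 1 / (√lam * (n : ℝ) ^ 2) by linarith)
  have h4 := massBelow_mono w i (show b ≤ a + 1 / (√lam * (n : ℝ) ^ 2) by linarith)
  constructor <;> linarith

theorem exists_massBelow_eq {w : L2 N} {g : L2Vec N} (hw : HasWeakGradient w g) (i : Fin N)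
    {lam : ℝ} (hlam : 0 < lam) (hg : ‖g‖ ^ 2 ≤ lam * ‖w‖ ^ 2) {v : ℝ} (h0 : 0 < v)
    (h1 : v < ‖w‖ ^ 2) : ∃ t, massBelow w i t = v := by
  have hbot : Filter.Tendsto (fun n : ℕ => massBelow w i (-n)) Filter.atTop (nhds 0) := by
    have := tendsto_setIntegral_of_antitone (μ := (volume : Measure (E N)))
      (s := fun n : ℕ => {x : E N | x i < -n}) (f := fun x => w x ^ 2)
      (fun n => measurableSet_coord_lt i _)
      (fun m n hmn x hx => by
        have : (m : ℝ) ≤ n := by exact_mod_cast hmn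
        simp only [Set.mem_ofPred_eq] at hx ⊢
        linarith)
      ⟨0, (integrable_sq w).integrableOn⟩
    have he : (⋂ n : ℕ, {x : E N | x i < -n}) = ∅ := by
      ext x
      simp only [Set.mem_iInter, Set.mem_ofPred_eq, Set.mem_empty_iff_false, iff_false, not_forall,
        not_lt]
      obtain ⟨n, hn⟩ := exists_nat_ge (-x i)
      exact ⟨n, by linarith⟩
    rwa [he, setIntegral_empty] at this
  have htop : Filter.Tendsto (fun n : ℕ => massBelow w i n) Filter.atTop (nhds (‖w‖ ^ 2)) := by
    have := tendsto_setIntegral_of_monotone (μ := (volume : Measure (E N)))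
      (s := fun n : ℕ => {x : E N | x i < n}) (f := fun x => w x ^ 2)
      (fun n => measurableSet_coord_lt i _)
      (fun m n hmn x hx => by
        have : (m : ℝ) ≤ n := by exact_mod_cast hmn
        simp only [Set.mem_ofPred_eq] at hx ⊢
        linarith)
      (integrable_sq w).integrableOn
    have he : (⋃ n : ℕ, {x : E N | x i < n}) = Set.univ := by
      ext x
      simpa using exists_nat_gt (x i)
    rwa [he, setIntegral_univ, ← norm_sq_eq_integral] at this
  refine mem_range_of_exists_le_of_exists_ge (continuous_massBelow hw i hlam hg) ?_ ?_
  · obtain ⟨n, hn⟩ := (hbot.eventually_lt_const h0).exists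
    exact ⟨_, hn.le⟩
  · obtain ⟨n, hn⟩ := (htop.eventually_const_lt h1).exists
    exact ⟨_, hn.le⟩

/-! ### Cutoff functions adapted to the mass distribution -/

theorem exists_bound_deriv_smoothTransition :
    ∃ D : ℝ, 0 < D ∧ ∀ t, |deriv Real.smoothTransition t| ≤ D := by
  have hcont : Continuous (deriv Real.smoothTransition) :=
    (Real.smoothTransition.contDiff (n := 1)).continuous_deriv (by simp)
  have hsupp : HasCompactSupport (deriv Real.smoothTransition) := by
    refine HasCompactSupport.intro (isCompact_Icc (a := (0 : ℝ)) (b := 1)) fun t ht => ?_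
    rw [Set.mem_Icc, not_and_or, not_le, not_le] at ht
    rcases ht with ht | ht
    · have : Real.smoothTransition =ᶠ[nhds t] fun _ => 0 := by
        filter_upwards [Iio_mem_nhds ht] with s hs
        exact Real.smoothTransition.zero_of_nonpos (le_of_lt hs)
      rw [this.deriv_eq, deriv_const]
    · have : Real.smoothTransition =ᶠ[nhds t] fun _ => 1 := by
        filter_upwards [Ioi_mem_nhds ht] with s hs
        exact Real.smoothTransition.one_of_one_le (le_of_lt hs)
      rw [this.deriv_eq, deriv_const]
  obtain ⟨D, hD⟩ := hcont.bounded_above_of_compact_support hsupp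
  exact ⟨max D 1, by positivity, fun t => (hD t).trans (le_max_left _ _)⟩

/-- The smooth step in the `i`-th coordinate which is `0` for `x i ≤ s` and `1` for
`x i ≥ s + l`. -/
noncomputable def coordStep (i : Fin N) (s l : ℝ) (x : E N) : ℝ :=
  Real.smoothTransition ((x i - s) / l)

theorem contDiff_coordStep (i : Fin N) (s l : ℝ) : ContDiff ℝ ∞ (coordStep i s l) :=
  Real.smoothTransition.contDiff.comp
    (((EuclideanSpace.proj (𝕜 := ℝ) i).contDiff.sub contDiff_const).div_const l)

theorem coordStep_eq_zero {i : Fin N} {s l : ℝ} (hl : 0 < l) {x : E N} (hx : x i ≤ s) :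
    coordStep i s l x = 0 :=
  Real.smoothTransition.zero_of_nonpos (div_nonpos_of_nonpos_of_nonneg (by linarith) hl.le)

theorem coordStep_eq_one {i : Fin N} {s l : ℝ} (hl : 0 < l) {x : E N} (hx : s + l ≤ x i) :
    coordStep i s l x = 1 :=
  Real.smoothTransition.one_of_one_le ((one_le_div hl).2 (by linarith))

theorem norm_fderiv_coordStep_le (i : Fin N) (s : ℝ) {l D : ℝ} (hl : 0 < l)
    (hD : ∀ t, |deriv Real.smoothTransition t| ≤ D) (x : E N) :
    ‖fderiv ℝ (coordStep i s l) x‖ ≤ D / l := by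
  have h1 : HasFDerivAt (fun x : E N => (x i - s) / l)
      (l⁻¹ • (EuclideanSpace.proj (𝕜 := ℝ) i : E N →L[ℝ] ℝ)) x := by
    simpa [div_eq_inv_mul] using
      (((EuclideanSpace.proj (𝕜 := ℝ) i : E N →L[ℝ] ℝ).hasFDerivAt (x := x)).sub_const s).const_mul
        l⁻¹
  have h2 : HasDerivAt Real.smoothTransition (deriv Real.smoothTransition ((x i - s) / l))
      ((x i - s) / l) :=
    ((Real.smoothTransition.contDiff (n := 1)).differentiable (by simp) _).hasDerivAt
  have h3 : HasFDerivAt (coordStep i s l) _ x := h2.comp_hasFDerivAt x h1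
  have h4 : ‖(EuclideanSpace.proj (𝕜 := ℝ) i : E N →L[ℝ] ℝ)‖ ≤ 1 :=
    ContinuousLinearMap.opNorm_le_bound _ zero_le_one fun y => by
      simpa using PiLp.norm_apply_le y i
  rw [h3.fderiv, norm_smul, norm_smul, Real.norm_eq_abs, norm_inv, Real.norm_eq_abs,
    abs_of_pos hl, div_eq_mul_inv]
  calc _ ≤ D * (l⁻¹ * 1) := by
        gcongr
        · exact (abs_nonneg _).trans (hD 0)
        · exact hD _
    _ = _ := by ring

/-- If `∫ |Dw|² ≤ lam ∫ w²`, there are `k` cutoff functions with gradients of size `√lam`, equal to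
one on disjoint sets each carrying a fixed fraction of the mass of `w`, and each vanishing on the
sets of the others. -/
theorem exists_cutoffs (k : ℕ) : ∃ C : ℝ, 0 < C ∧ ∀ {N : ℕ} (_ : Fin N) {w : L2 N} {g : L2Vec N}
    {lam : ℝ}, HasWeakGradient w g → w ≠ 0 → 0 < lam → ‖g‖ ^ 2 ≤ lam * ‖w‖ ^ 2 →
    ∃ (φ : Fin k → E N → ℝ) (P : Fin k → Set (E N)),
      (∀ j, ContDiff ℝ ∞ (φ j)) ∧ (∀ j x, |φ j x| ≤ 1) ∧
      (∀ j x, ‖gradient (φ j) x‖ ≤ C * √lam) ∧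
      (∀ j, MeasurableSet (P j)) ∧
      (∀ i j, ∀ x ∈ P i, φ j x = if j = i then 1 else 0) ∧
      ∀ j, ‖w‖ ^ 2 / (2 * (k + 2)) ≤ ∫ x in P j, w x ^ 2 := by
  obtain ⟨D, hD0, hD⟩ := exists_bound_deriv_smoothTransition
  -- With `n = 8 (k + 2)`, a transition layer takes at most half of the mass between two quantiles.
  let n : ℕ := 8 * (k + 2)
  have hn : (n : ℝ) = 8 * (k + 2) := by simp [n]
  have hn0 : (0 : ℝ) < n := by rw [hn]; positivity
  refine ⟨2 * D * (n : ℝ) ^ 2, by positivity, ?_⟩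
  intro N i w g lam hw hw0 hlam hg
  set l : ℝ := 1 / (√lam * (n : ℝ) ^ 2) with hl_def
  have hl : 0 < l := by positivity
  have hm : 0 < ‖w‖ ^ 2 := by
    have := norm_pos_iff.2 hw0
    positivity
  have hlayer : ∀ a, massBelow w i (a + l) ≤ massBelow w i a + ‖w‖ ^ 2 / (2 * (k + 2)) := by
    intro a
    refine (massBelow_add_le hw i hlam hg (Nat.cast_pos.1 hn0) hl le_rfl a).trans_eq ?_
    rw [hn]
    field_simp
    ring
  have hq : ∀ j : ℕ, ∃ t, j ≤ k → massBelow w i t = (j + 1) / (k + 2) * ‖w‖ ^ 2 := by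
    intro j
    by_cases hj : j ≤ k
    · have hj' : (j : ℝ) ≤ k := by exact_mod_cast hj
      obtain ⟨t, ht⟩ := exists_massBelow_eq hw i hlam hg
        (v := (j + 1) / (k + 2) * ‖w‖ ^ 2) (by positivity) (by
          rw [div_mul_eq_mul_div, div_lt_iff₀ (by positivity), mul_comm]
          exact mul_lt_mul_of_pos_left (by linarith) hm)
      exact ⟨t, fun _ => ht⟩
    · exact ⟨0, fun h => absurd h hj⟩
  choose s hs using hq
  have hmono : ∀ a b : ℕ, a < b → b ≤ k → s a ≤ s b := by
    intro a b hab hb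
    by_contra! h
    have h1 := massBelow_mono w i h.le
    rw [hs a (by lia), hs b hb] at h1
    have h2 : (a : ℝ) < b := by exact_mod_cast hab
    have : ((a : ℝ) + 1) / (k + 2) * ‖w‖ ^ 2 < (b + 1) / (k + 2) * ‖w‖ ^ 2 := by gcongr
    linarith
  have hmono' : ∀ a b : ℕ, a ≤ b → b ≤ k → s a ≤ s b := by
    intro a b hab hb
    rcases hab.eq_or_lt with rfl | h
    · exact le_rfl
    · exact hmono a b h hb
  refine ⟨fun j x => coordStep i (s j) l x - coordStep i (s (j + 1)) l x,
    fun j => {x | s j + l ≤ x i ∧ x i < s (j + 1)}, ?_, ?_, ?_, ?_, ?_, ?_⟩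
  · exact fun j => (contDiff_coordStep i _ l).sub (contDiff_coordStep i _ l)
  · intro j x
    rw [abs_le]
    have h1 := Real.smoothTransition.nonneg ((x i - s j) / l)
    have h2 := Real.smoothTransition.le_one ((x i - s j) / l)
    have h3 := Real.smoothTransition.nonneg ((x i - s (j + 1)) / l)
    have h4 := Real.smoothTransition.le_one ((x i - s (j + 1)) / l)
    simp only [coordStep]
    constructor <;> linarith
  · intro j x
    rw [gradient, LinearIsometryEquiv.norm_map, fderiv_fun_sub
      ((contDiff_coordStep i _ l).differentiable (by simp) x)
      ((contDiff_coordStep i _ l).differentiable (by simp) x)]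
    refine (norm_sub_le _ _).trans ?_
    refine (add_le_add (norm_fderiv_coordStep_le i _ hl hD x)
      (norm_fderiv_coordStep_le i _ hl hD x)).trans_eq ?_
    rw [hl_def]
    field_simp
    ring
  · exact fun j => measurableSet_slab i _ _
  · rintro a b x ⟨hx1, hx2⟩
    dsimp only
    rcases lt_trichotomy b.1 a.1 with h | h | h
    · rw [if_neg (Fin.ne_of_lt h), coordStep_eq_one hl, coordStep_eq_one hl, sub_self]
      · exact (add_le_add_left (hmono' _ _ (by lia) (by lia)) l).trans hx1
      · exact (add_le_add_left (hmono' _ _ (by lia) (by lia)) l).trans hx1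
    · rw [if_pos (Fin.ext h), coordStep_eq_one hl (by rwa [h]),
        coordStep_eq_zero hl (by rw [h]; exact hx2.le), sub_zero]
    · rw [if_neg (Fin.ne_of_gt h), coordStep_eq_zero hl, coordStep_eq_zero hl, sub_self]
      · exact hx2.le.trans (hmono' _ _ (by lia) (by lia))
      · exact hx2.le.trans (hmono' _ _ (by lia) (by lia))
  · intro j
    have h0 := hs j (by lia)
    have h1 := hs (j + 1) (by lia)
    have h2 := hlayer (s j)
    have h4 : massBelow w i (s (j + 1)) - massBelow w i (s j) = ‖w‖ ^ 2 / (k + 2) := by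
      rw [h0, h1]
      push_cast
      ring
    have h5 : ‖w‖ ^ 2 / (2 * ((k : ℝ) + 2)) = ‖w‖ ^ 2 / (k + 2) / 2 := by
      field_simp
    have h6 : 0 < ‖w‖ ^ 2 / ((k : ℝ) + 2) := by positivity
    have h7 : s j + l ≤ s (j + 1) := by
      by_contra! h
      have := massBelow_mono w i h.le
      linarith
    rw [integral_slab w i h7]
    linarith

/-! ### Multiplication by smooth functions in `W_0^{1,2}(A)` -/

theorem capacity_mono {S T : Set (E N)} (h : S ⊆ T) : capacity S ≤ capacity T := by
  refine le_iInf fun φ => le_iInf fun h1 => le_iInf fun h2 => le_iInf fun h3 => ?_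
  obtain ⟨U, hU, hTU, hφ⟩ := h3
  exact iInf_le_of_le φ (iInf_le_of_le h1 (iInf_le_of_le h2
    (iInf_le_of_le ⟨U, hU, h.trans hTU, hφ⟩ le_rfl)))

/-- Sets of zero capacity are Lebesgue null; `volume S` is an outer measure here, as `S` need not be
measurable. -/
theorem volume_le_capacity (S : Set (E N)) : volume S ≤ capacity S := by
  refine le_iInf fun φ => le_iInf fun _ => le_iInf fun _ => le_iInf fun h3 => ?_
  obtain ⟨U, hU, hSU, hφ⟩ := h3
  calc volume S ≤ volume U := measure_mono hSU
    _ = ∫⁻ _ in U, 1 := (setLIntegral_one U).symm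
    _ ≤ ∫⁻ x in U, ENNReal.ofReal (φ x ^ 2) := by
        refine lintegral_mono_ae ?_
        refine (ae_restrict_iff' hU.measurableSet).2 ?_
        filter_upwards [hφ] with x hx hxU
        rw [← ENNReal.ofReal_one]
        exact ENNReal.ofReal_le_ofReal (one_le_pow₀ (hx hxU))
    _ ≤ ∫⁻ x, ENNReal.ofReal (φ x ^ 2) := setLIntegral_le_lintegral _ _
    _ = ENNReal.ofReal (‖φ‖ ^ 2) := by
        rw [norm_sq_eq_integral, ofReal_integral_eq_lintegral_ofReal (integrable_sq φ)
          (.of_forall fun _ => sq_nonneg _)]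
    _ ≤ _ := ENNReal.ofReal_le_ofReal (by nlinarith [sq_nonneg ‖weakGrad φ‖])

theorem ae_eq_zero_of_mem_W012 {A : Set (E N)} {u : L2 N} (hu : u ∈ W012 A) :
    ∀ᵐ x, x ∉ A → u x = 0 := by
  obtain ⟨-, v, -, hvu, hcap⟩ := hu
  have h0 : volume {x | x ∉ A ∧ v x ≠ 0} = 0 :=
    le_antisymm ((volume_le_capacity _).trans hcap.le) bot_le
  filter_upwards [hvu, compl_mem_ae_iff.2 h0] with x hx hx' hxA
  by_contra h
  exact hx' ⟨hxA, by rwa [hx]⟩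

theorem memLp_mul_bounded (w : L2 N) {Φ : E N → ℝ} (hΦ : Continuous Φ) {B : ℝ}
    (hB : ∀ x, |Φ x| ≤ B) : MemLp (fun x => Φ x * w x) 2 (volume : Measure (E N)) :=
  (Lp.memLp w).of_le_mul (c := B) (hΦ.aestronglyMeasurable.mul (Lp.memLp w).1)
    (.of_forall fun x => by
      rw [norm_mul, Real.norm_eq_abs]
      exact mul_le_mul_of_nonneg_right (hB x) (norm_nonneg _))

/-- `W_0^{1,2}(A)` is stable under multiplication by bounded smooth functions with bounded
gradient. -/
theorem mul_smooth_mem_W012 {A : Set (E N)} {w v : L2 N} (hw : w ∈ W012 A) {Φ : E N → ℝ}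
    (hΦ : ContDiff ℝ ∞ Φ) {B B' : ℝ} (hB : ∀ x, |Φ x| ≤ B) (hB' : ∀ x, ‖gradient Φ x‖ ≤ B')
    (hv : v =ᵐ[volume] fun x => Φ x * w x) :
    v ∈ W012 A ∧ ‖weakGrad v‖ ^ 2 ≤ 2 * B ^ 2 * ‖weakGrad w‖ ^ 2 + 2 * B' ^ 2 * ‖w‖ ^ 2 := by
  obtain ⟨hwW, f, hf, hfw, hcap⟩ := hw
  have hg := hasWeakGradient_weakGrad hwW
  set g := weakGrad w
  have hL1 : MemLp (fun x => Φ x • g x) 2 (volume : Measure (E N)) :=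
    (Lp.memLp g).of_le_mul (c := B) (hΦ.continuous.aestronglyMeasurable.smul (Lp.memLp g).1)
      (.of_forall fun x => by
        rw [norm_smul, Real.norm_eq_abs]
        exact mul_le_mul_of_nonneg_right (hB x) (norm_nonneg _))
  have hL2 : MemLp (fun x => w x • gradient Φ x) 2 (volume : Measure (E N)) :=
    (Lp.memLp w).of_le_mul (c := B')
      ((Lp.memLp w).1.smul (continuous_gradient hΦ).aestronglyMeasurable)
      (.of_forall fun x => by
        rw [norm_smul, mul_comm]
        exact mul_le_mul_of_nonneg_right (hB' x) (norm_nonneg _))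
  have hh := (hL1.add hL2).coeFn_toLp
  set h : L2Vec N := (hL1.add hL2).toLp
  have hvh : HasWeakGradient v h := hg.mul_smooth hΦ hv hh
  refine ⟨⟨⟨h, hvh⟩, fun x => Φ x * f x, ?_, ?_, ?_⟩, ?_⟩
  · intro ε hε
    obtain ⟨G, hG, hGε, hGf⟩ := hf ε hε
    exact ⟨G, hG, hGε, hΦ.continuous.continuousOn.mul hGf⟩
  · filter_upwards [hv, hfw] with x h1 h2
    rw [h1, h2]
  · refine le_antisymm ((capacity_mono ?_).trans hcap.le) bot_le
    rintro x ⟨hxA, hx⟩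
    exact ⟨hxA, right_ne_zero_of_mul hx⟩
  · rw [hvh.weakGrad_eq, norm_sq_eq_integral_vec, norm_sq_eq_integral_vec, norm_sq_eq_integral,
      ← integral_const_mul, ← integral_const_mul, ← integral_add
        ((integrable_norm_sq_vec g).const_mul _) ((integrable_sq w).const_mul _)]
    refine integral_mono_ae (integrable_norm_sq_vec h)
      (((integrable_norm_sq_vec g).const_mul _).add ((integrable_sq w).const_mul _)) ?_
    filter_upwards [hh] with x hx
    rw [hx]
    simp only [Pi.add_apply]
    have h1 : ‖Φ x • g x‖ ≤ B * ‖g x‖ := by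
      rw [norm_smul, Real.norm_eq_abs]
      exact mul_le_mul_of_nonneg_right (hB x) (norm_nonneg _)
    have h2 : ‖w x • gradient Φ x‖ ≤ B' * |w x| := by
      rw [norm_smul, mul_comm, Real.norm_eq_abs]
      exact mul_le_mul_of_nonneg_right (hB' x) (abs_nonneg _)
    calc ‖Φ x • g x + w x • gradient Φ x‖ ^ 2 ≤ (B * ‖g x‖ + B' * |w x|) ^ 2 := by
          gcongr
          exact (norm_add_le _ _).trans (add_le_add h1 h2)
      _ ≤ 2 * (B * ‖g x‖) ^ 2 + 2 * (B' * |w x|) ^ 2 := by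
          nlinarith [sq_nonneg (B * ‖g x‖ - B' * |w x|)]
      _ = _ := by
          rw [mul_pow, mul_pow, sq_abs]
          ring

/-! ### Test spaces built from a single function -/

theorem gradient_sum_mul {ι : Type*} [Fintype ι] {φ : ι → E N → ℝ}
    (hφ : ∀ j, ContDiff ℝ ∞ (φ j)) (c : ι → ℝ) (x : E N) :
    gradient (fun y => ∑ j, c j * φ j y) x = ∑ j, c j • gradient (φ j) x := by
  have hd : ∀ j, DifferentiableAt ℝ (φ j) x := fun j => (hφ j).differentiable (by simp) x
  simp only [gradient]
  rw [fderiv_fun_sum fun j _ => (hd j).const_mul (c j), map_sum]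
  refine Finset.sum_congr rfl fun j _ => ?_
  rw [fderiv_const_mul (hd j)]
  simp

/-- From one function `w ∈ W_0^{1,2}(A)` with Rayleigh quotient at most `lam` one gets a
`k`-dimensional subspace of `W_0^{1,2}(A)` on which the Rayleigh quotient is at most `M lam`: the
span of the products of `w` with `k` cutoff functions adapted to its mass distribution. -/
theorem exists_testSpace (k : ℕ) : ∃ M : ℝ, 0 < M ∧ ∀ {N : ℕ} (_ : Fin N) {A : Set (E N)}
    {w : L2 N} {lam : ℝ}, w ∈ W012 A → w ≠ 0 → 0 < lam → ‖weakGrad w‖ ^ 2 ≤ lam * ‖w‖ ^ 2 →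
    ∃ K : Submodule ℝ (L2 N), Module.finrank ℝ K = k ∧ (K : Set (L2 N)) ⊆ W012 A ∧
      ∀ v ∈ K, ‖weakGrad v‖ ^ 2 ≤ M * lam * ‖v‖ ^ 2 := by
  obtain ⟨C, hC, hcut⟩ := exists_cutoffs k
  refine ⟨4 * (k + 1) * (k + 2) * (1 + C ^ 2), by positivity, ?_⟩
  intro N i A w lam hw hw0 hlam hray
  obtain ⟨φ, P, hφ, hφ1, hφ', hPm, hφP, hP⟩ :=
    hcut i (hasWeakGradient_weakGrad hw.1) hw0 hlam hray
  have hm : 0 < ‖w‖ ^ 2 := by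
    have := norm_pos_iff.2 hw0
    positivity
  have hmem : ∀ j, MemLp (fun x => φ j x * w x) 2 (volume : Measure (E N)) :=
    fun j => memLp_mul_bounded w (hφ j).continuous (hφ1 j)
  let T : (Fin k → ℝ) →ₗ[ℝ] L2 N := Fintype.linearCombination ℝ fun j => (hmem j).toLp
  let Φ : (Fin k → ℝ) → E N → ℝ := fun c x => ∑ j, c j * φ j x
  have hT : ∀ c, T c =ᵐ[volume] fun x => Φ c x * w x := by
    intro c
    have h1 : ∀ᵐ x, ∀ j, (hmem j).toLp (fun x => φ j x * w x) x = φ j x * w x :=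
      ae_all_iff.2 fun j => (hmem j).coeFn_toLp
    have h2 : ∀ᵐ x, ∀ j, (c j • (hmem j).toLp (fun x => φ j x * w x) : L2 N) x
        = c j * (hmem j).toLp (fun x => φ j x * w x) x :=
      ae_all_iff.2 fun j => Lp.coeFn_smul _ _
    have h3 : (T c : E N → ℝ) =ᵐ[volume]
        ∑ j, ((c j • (hmem j).toLp (fun x => φ j x * w x) : L2 N) : E N → ℝ) := by
      simp only [T, Fintype.linearCombination_apply]
      exact Lp.coeFn_finsetSum ..
    filter_upwards [h1, h2, h3] with x h1 h2 h3
    rw [h3, Finset.sum_apply, Finset.sum_mul]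
    refine Finset.sum_congr rfl fun j _ => ?_
    rw [h2, h1, mul_assoc]
  have hdisj : Pairwise (Function.onFun Disjoint P) := by
    intro a b hab
    refine Set.disjoint_left.2 fun x hxa hxb => ?_
    have h1 := hφP a a x hxa
    have h2 := hφP b a x hxb
    rw [if_pos rfl] at h1
    rw [if_neg hab, h1] at h2
    exact one_ne_zero h2
  -- The combination `T c` equals `c j * w` on `P j`, so its norm controls `∑ c j ^ 2`.
  have hlower : ∀ c, (∑ j, c j ^ 2) * (‖w‖ ^ 2 / (2 * (k + 2))) ≤ ‖T c‖ ^ 2 := by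
    intro c
    calc (∑ j, c j ^ 2) * (‖w‖ ^ 2 / (2 * (k + 2)))
        = ∑ j, c j ^ 2 * (‖w‖ ^ 2 / (2 * (k + 2))) := Finset.sum_mul _ _ _
      _ ≤ ∑ j, c j ^ 2 * ∫ x in P j, w x ^ 2 := by
          gcongr with j
          exact hP j
      _ = ∑ j, ∫ x in P j, T c x ^ 2 := by
          refine Finset.sum_congr rfl fun j _ => ?_
          rw [← integral_const_mul]
          refine setIntegral_congr_ae (hPm j) ?_
          filter_upwards [hT c] with x hx hxP
          rw [hx, mul_pow]
          simp [Φ, hφP j _ x hxP]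
      _ = ∫ x in ⋃ j, P j, T c x ^ 2 :=
          (integral_iUnion_fintype hPm hdisj fun j => (integrable_sq (T c)).integrableOn).symm
      _ ≤ ‖T c‖ ^ 2 := by
          rw [norm_sq_eq_integral]
          exact setIntegral_le_integral (integrable_sq (T c)) (.of_forall fun _ => sq_nonneg _)
  -- `T c` is the product of `w` with the single multiplier `∑ c j φ j`, hence in `W_0^{1,2}(A)`.
  have hupper : ∀ c, T c ∈ W012 A ∧
      ‖weakGrad (T c)‖ ^ 2 ≤ 4 * (k + 1) * (k + 2) * (1 + C ^ 2) * lam * ‖T c‖ ^ 2 := by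
    intro c
    have hB : ∀ x, |Φ c x| ≤ ∑ j, |c j| := by
      intro x
      refine (Finset.abs_sum_le_sum_abs _ _).trans (Finset.sum_le_sum fun j _ => ?_)
      rw [abs_mul]
      exact mul_le_of_le_one_right (abs_nonneg _) (hφ1 j x)
    have hB' : ∀ x, ‖gradient (Φ c) x‖ ≤ C * √lam * ∑ j, |c j| := by
      intro x
      rw [gradient_sum_mul hφ, Finset.mul_sum]
      refine (norm_sum_le _ _).trans (Finset.sum_le_sum fun j _ => ?_)
      rw [norm_smul, Real.norm_eq_abs, mul_comm]
      exact mul_le_mul_of_nonneg_right (hφ' j x) (abs_nonneg _)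
    have hΦ : ContDiff ℝ ∞ (Φ c) := ContDiff.sum fun j _ => contDiff_const.mul (hφ j)
    obtain ⟨h1, h2⟩ := mul_smooth_mem_W012 hw hΦ hB hB' (hT c)
    refine ⟨h1, h2.trans ?_⟩
    have hcs : (∑ j, |c j|) ^ 2 ≤ (k + 1) * ∑ j, c j ^ 2 := by
      have := sq_sum_le_card_mul_sum_sq (s := Finset.univ) (f := fun j => |c j|)
      simp only [sq_abs, Finset.card_univ, Fintype.card_fin] at this
      have h0 : 0 ≤ ∑ j, c j ^ 2 := Finset.sum_nonneg fun j _ => sq_nonneg _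
      linarith
    calc 2 * (∑ j, |c j|) ^ 2 * ‖weakGrad w‖ ^ 2 + 2 * (C * √lam * ∑ j, |c j|) ^ 2 * ‖w‖ ^ 2
        = 2 * (∑ j, |c j|) ^ 2 * (‖weakGrad w‖ ^ 2 + C ^ 2 * lam * ‖w‖ ^ 2) := by
          rw [mul_pow, mul_pow, Real.sq_sqrt hlam.le]
          ring
      _ ≤ 2 * ((k + 1) * ∑ j, c j ^ 2) * (lam * ‖w‖ ^ 2 + C ^ 2 * lam * ‖w‖ ^ 2) := by
          gcongr
      _ = 4 * (k + 1) * (k + 2) * (1 + C ^ 2) * lam *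
            ((∑ j, c j ^ 2) * (‖w‖ ^ 2 / (2 * (k + 2)))) := by
          field_simp
          ring
      _ ≤ _ := by
          gcongr
          exact hlower c
  have hinj : Function.Injective T := by
    rw [← LinearMap.ker_eq_bot, LinearMap.ker_eq_bot']
    intro c hc
    have h1 := hlower c
    rw [hc, norm_zero, zero_pow two_ne_zero] at h1
    have h2 : ∑ j, c j ^ 2 ≤ 0 := nonpos_of_mul_nonpos_left h1 (by positivity)
    have h3 : ∑ j, c j ^ 2 = 0 := le_antisymm h2 (Finset.sum_nonneg fun j _ => sq_nonneg _)
    rw [Finset.sum_eq_zero_iff_of_nonneg fun j _ => sq_nonneg _] at h3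
    funext j
    exact pow_eq_zero_iff two_ne_zero |>.1 (h3 j (Finset.mem_univ j))
  refine ⟨LinearMap.range T, ?_, ?_, ?_⟩
  · rw [LinearMap.finrank_range_of_inj hinj, Module.finrank_fin_fun]
  · rintro _ ⟨c, rfl⟩
    exact (hupper c).1
  · rintro _ ⟨c, rfl⟩
    exact (hupper c).2

theorem dirichletEigenvalue_le {A : Set (E N)} {k : ℕ} {K : Submodule ℝ (L2 N)}
    (hK : Module.finrank ℝ K = k) (hKA : (K : Set (L2 N)) ⊆ W012 A) {R : ℝ}
    (hR : ∀ v ∈ K, ‖weakGrad v‖ ^ 2 ≤ R * ‖v‖ ^ 2) :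
    dirichletEigenvalue A k ≤ ENNReal.ofReal R := by
  refine iInf_le_of_le K (iInf_le_of_le hK (iInf_le_of_le hKA ?_))
  refine iSup_le fun v => iSup_le fun hv => iSup_le fun hv0 => ENNReal.ofReal_le_ofReal ?_
  have := norm_pos_iff.2 hv0
  exact (div_le_iff₀ (by positivity)).2 (hR v hv)

/-! ### Discrete spectra -/

/-- Vanishing off `A` is a closed condition in `L²`, for an arbitrary, possibly nonmeasurable, set
`A`. -/
theorem ae_eq_zero_of_tendsto_L2 {A : Set (E N)} {f : ℕ → L2 N} {g : L2 N}
    (hf : ∀ n, ∀ᵐ x, x ∉ A → f n x = 0) (hfg : Filter.Tendsto f Filter.atTop (nhds g)) :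
    ∀ᵐ x, x ∉ A → g x = 0 := by
  obtain ⟨ns, -, hns⟩ := (tendstoInMeasure_of_tendsto_Lp hfg).exists_seq_tendsto_ae
  filter_upwards [hns, ae_all_iff.2 hf] with x hx h0 hxA
  refine tendsto_nhds_unique hx ?_
  simp [h0 _ hxA]

/-- The variational lower bound for discrete spectra: a function of `W_0^{1,2}(A)` orthogonal to
the first `m` eigenfunctions has Rayleigh quotient at least `μ m`. -/
theorem le_norm_weakGrad_sq {A : Set (E N)} {μ : ℕ → ℝ} (hμ : Monotone μ) {u : ℕ → L2 N}
    (hu : Orthonormal ℝ u) (huA : ∀ i, u i ∈ W012 A)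
    (hweak : ∀ i, ∀ v ∈ W012 A,
      inner ℝ (weakGrad (u i)) (weakGrad v) = μ i * inner ℝ (u i) v)
    (hcomplete : ∀ f : L2 N, (∀ᵐ x, x ∉ A → f x = 0) → (∀ i, inner ℝ (u i) f = 0) → f = 0)
    {w : L2 N} (hw : w ∈ W012 A) {m : ℕ} (horth : ∀ i < m, inner ℝ (u i) w = 0) :
    μ m * ‖w‖ ^ 2 ≤ ‖weakGrad w‖ ^ 2 := by
  let c : ℕ → ℝ := fun i => inner ℝ (u i) w
  have hsummable : Summable fun i => c i • u i := by
    refine (hu.orthogonalFamily.summable_iff_norm_sq_summable c).2 ?_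
    exact hu.inner_products_summable w
  obtain ⟨g, hg⟩ := hsummable
  -- Completeness concerns functions vanishing off `A`; this property passes to the `L²` limit `g`.
  have hgw : w - g = 0 := by
    refine hcomplete _ ?_ fun i => ?_
    · have hpart : ∀ n, ∀ᵐ x, x ∉ A → (w - ∑ i ∈ Finset.range n, c i • u i : L2 N) x = 0 := by
        intro n
        induction n with
        | zero => simpa using ae_eq_zero_of_mem_W012 hw
        | succ n ih =>
          rw [Finset.sum_range_succ, ← sub_sub]
          filter_upwards [ih, ae_eq_zero_of_mem_W012 (huA n), Lp.coeFn_smul (c n) (u n),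
            Lp.coeFn_sub (w - ∑ i ∈ Finset.range n, c i • u i) (c n • u n)] with x h1 h2 h3 h4 hxA
          rw [h4, Pi.sub_apply, h3, Pi.smul_apply, h1 hxA, h2 hxA]
          simp
      exact ae_eq_zero_of_tendsto_L2 hpart (tendsto_const_nhds.sub hg.tendsto_sum_nat)
    · have h1 : HasSum (fun j => inner ℝ (u i) (c j • u j)) (inner ℝ (u i) g) :=
        (innerSL ℝ (u i)).hasSum hg
      have h2 : HasSum (fun j => inner ℝ (u i) (c j • u j)) (inner ℝ (u i) (c i • u i)) :=
        hasSum_single i fun j hj => by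
          rw [inner_smul_right, hu.2 hj.symm, mul_zero]
      rw [inner_sub_right, h1.unique h2, inner_smul_right, real_inner_self_eq_norm_sq, hu.1 i]
      simp [c]
  rw [← sub_eq_zero.1 hgw] at hg
  have hparseval : HasSum (fun i => c i ^ 2) (‖w‖ ^ 2) := by
    have h1 : HasSum (fun j => inner ℝ w (c j • u j)) (inner ℝ w w) := (innerSL ℝ w).hasSum hg
    rw [real_inner_self_eq_norm_sq] at h1
    convert h1 using 2 with j
    rw [inner_smul_right, real_inner_comm, sq]
  have hlim := hparseval.tendsto_sum_nat.const_mul (μ m)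
  refine le_of_tendsto' hlim fun n => ?_
  let s : L2Vec N := ∑ i ∈ Finset.range n, c i • weakGrad (u i)
  let σ : ℝ := ∑ i ∈ Finset.range n, μ i * c i ^ 2
  have hws : inner ℝ s (weakGrad w) = σ := by
    simp only [s, σ, sum_inner, inner_smul_left]
    refine Finset.sum_congr rfl fun i _ => ?_
    rw [hweak i w hw]
    simp [c]
    ring
  have hss : inner ℝ s s = σ := by
    simp only [s, σ, sum_inner, inner_sum, inner_smul_left, inner_smul_right]
    refine Finset.sum_congr rfl fun i hi => ?_
    rw [Finset.sum_eq_single i]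
    · rw [hweak i _ (huA i), real_inner_self_eq_norm_sq, hu.1 i]
      simp
      ring
    · intro j _ hj
      rw [hweak j _ (huA i), hu.2 hj]
      simp
    · exact fun h => absurd hi h
  -- `s` is the projection of `Dw` to the span of the first gradients `D(u i)`.
  have hbessel : σ ≤ ‖weakGrad w‖ ^ 2 := by
    have h1 := norm_sub_sq_real s (weakGrad w)
    rw [hws, ← real_inner_self_eq_norm_sq s, hss] at h1
    nlinarith [sq_nonneg ‖s - weakGrad w‖]
  refine le_trans ?_ hbessel
  rw [Finset.mul_sum]
  refine Finset.sum_le_sum fun i _ => ?_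
  rcases lt_or_ge i m with h | h
  · simp [c, horth i h]
  · exact mul_le_mul_of_nonneg_right (hμ h) (sq_nonneg _)

theorem IsDirichletSpectrum.le_of_testSpace {A : Set (E N)} {μ : ℕ → ℝ}
    (hμ : IsDirichletSpectrum A μ) {k : ℕ} (hk : 1 ≤ k) {K : Submodule ℝ (L2 N)}
    (hK : Module.finrank ℝ K = k) (hKA : (K : Set (L2 N)) ⊆ W012 A) {R : ℝ}
    (hR : ∀ v ∈ K, ‖weakGrad v‖ ^ 2 ≤ R * ‖v‖ ^ 2) : μ (k - 1) ≤ R := by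
  obtain ⟨hmono, u, hu, huA, hweak, hcomplete⟩ := hμ
  have : FiniteDimensional ℝ K := Module.finite_of_finrank_pos (by rw [hK]; lia)
  let F : K →ₗ[ℝ] (Fin (k - 1) → ℝ) :=
    LinearMap.pi fun i => (innerₛₗ ℝ (u i)).comp K.subtype
  have hker : LinearMap.ker F ≠ ⊥ := by
    refine LinearMap.ker_ne_bot_of_finrank_lt ?_
    rw [hK, Module.finrank_fin_fun]
    lia
  obtain ⟨⟨w, hwK⟩, hwF, hw0⟩ := Submodule.exists_mem_ne_zero_of_ne_bot hker
  have hw0' : w ≠ 0 := fun h => hw0 (Subtype.ext h)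
  have horth : ∀ i < k - 1, inner ℝ (u i) w = 0 := fun i hi => congrFun hwF ⟨i, hi⟩
  have h1 := le_norm_weakGrad_sq hmono hu huA hweak hcomplete (hKA hwK) horth
  have hpos : 0 < ‖w‖ ^ 2 := by
    have := norm_pos_iff.2 hw0'
    positivity
  exact le_of_mul_le_mul_right (h1.trans (hR w hwK)) hpos

end DirichletSpectrum

/-! ### The ratio bound -/

open DirichletSpectrum in
theorem mainTheorem2 (N k : ℕ) (hN : 2 ≤ N) (hk : 1 ≤ k) :
    ∃ M : ℝ, 0 < M ∧ ∀ A : Set (E N), IsQuasiOpen A →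
      dirichletEigenvalue A k ≤ ENNReal.ofReal M * dirichletEigenvalue A 1 ∧
      ∀ μ : ℕ → ℝ, IsDirichletSpectrum A μ → μ (k - 1) ≤ M * μ 0 := by
  obtain ⟨M, hM, hspace⟩ := exists_testSpace k
  have i : Fin N := ⟨0, by lia⟩
  refine ⟨M, hM, fun A _ => ⟨?_, fun μ hμ => ?_⟩⟩
  · rw [dirichletEigenvalue.eq_def A 1]
    have hM0 : ENNReal.ofReal M ≠ 0 := (ENNReal.ofReal_pos.2 hM).ne'
    simp only [ENNReal.mul_iInf_of_ne hM0 ENNReal.ofReal_ne_top]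
    refine le_iInf fun K => le_iInf fun hK => le_iInf fun hKA => ?_
    have hK0 : K ≠ ⊥ := by
      rintro rfl
      simp at hK
    obtain ⟨w, hwK, hw0⟩ := Submodule.exists_mem_ne_zero_of_ne_bot hK0
    have hwpos := norm_pos_iff.2 hw0
    have hray : 0 ≤ rayleigh w := by
      unfold rayleigh
      positivity
    calc dirichletEigenvalue A k ≤ ENNReal.ofReal M * ENNReal.ofReal (rayleigh w) := by
          -- The slack `ε / M` makes the level positive even if `rayleigh w` were to vanish.
          refine ENNReal.le_of_forall_pos_le_add fun ε hε _ => ?_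
          have hε' : (0 : ℝ) < ε := hε
          obtain ⟨K', hK', hK'A, hK'R⟩ := hspace i (lam := rayleigh w + ε / M) (hKA hwK) hw0
            (by positivity) (by
              rw [add_mul, rayleigh, div_mul_cancel₀ _ (by positivity)]
              exact le_add_of_nonneg_right (by positivity))
          refine (dirichletEigenvalue_le hK' hK'A hK'R).trans_eq ?_
          rw [mul_add, mul_div_cancel₀ _ hM.ne', ENNReal.ofReal_add (by positivity) hε'.le,
            ENNReal.ofReal_mul hM.le, ENNReal.ofReal_coe_nnreal]
      _ ≤ _ := by
          gcongr
          exact le_iSup_of_le w (le_iSup_of_le hwK (le_iSup_of_le hw0 le_rfl))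
  · have hμ' := hμ
    obtain ⟨-, u, hu, huA, hweak, -⟩ := hμ'
    have hu0 : u 0 ≠ 0 := hu.ne_zero 0
    have hgrad : ‖weakGrad (u 0)‖ ^ 2 = μ 0 := by
      rw [← real_inner_self_eq_norm_sq, hweak 0 _ (huA 0), real_inner_self_eq_norm_sq, hu.1 0]
      simp
    have hμ0 : 0 ≤ μ 0 := hgrad ▸ sq_nonneg _
    refine le_of_forall_pos_le_add fun ε hε => ?_
    obtain ⟨K, hK, hKA, hKR⟩ := hspace i (lam := μ 0 + ε / M) (huA 0) hu0 (by positivity) (by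
      rw [hgrad, hu.1 0]
      have : 0 < ε / M := by positivity
      linarith)
    refine (hμ.le_of_testSpace hk hK hKA hKR).trans_eq ?_
    rw [mul_add, mul_div_cancel₀ _ hM.ne']
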